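/- Let $a,b,c>0$. In the plane put $D=\{x=a,\ 0<y<b\}$, $A_0=D\cup\{0<x<a\}$, $A_1=A_0\cap\{y>0\}$, $B_0=D\cup\{x>a\}$, $B_1=B_0\cap\{y>0\}$, $B_2=B_0\cap\{y<b\}$, $B_3=B_0\cap\{0<y<b\}$, and for $i\in\{0,1\}$, $j\in\{0,1,2,3\}$ consider the spatial corridor $S_{ij}=(A_i\cup B_j)\times(0,c)\subset\mathbb R^3$. An open line segment $K\subset\mathbb R^3$ of positive length can move around the corner in $S_{ij}$ if there is a continuous path $(\Phi_t)_{t\in[0,1]}$ of rigid motions of $\mathbb R^3$ such that $\Phi_0(K)\subset A_i\times(0,c)$, $\Phi_1(K)\subset B_j\times(0,c)$ and $\Phi_t(K)\subset S_{ij}$ for all $t\in[0,1]$. For each of the corridors $S_{03}$, $S_{11}$, $S_{13}$, the supremum of the lengths of the line segments that can move around the corner is $$\bigl((a^{2/3}+b^{2/3})^{3}+c^2\bigr)^{1/2}.$$ In each of the remaining five corridors $S_{00},S_{01},S_{02},S_{10},S_{12}$, line segments of every positive length can move around the corner. -/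

import Mathlib

/-- Euclidean three-space, with coordinates `v 0 = x`, `v 1 = y`, `v 2 = z`. -/
abbrev Space : Type := EuclideanSpace ℝ (Fin 3)

/-- The open door `D = {x = a, 0 < y < b}` in the plane. -/
def door (a b : ℝ) : Set (ℝ × ℝ) := {p | p.1 = a ∧ 0 < p.2 ∧ p.2 < b}

/-- The planar regions `A_0 = D ∪ {0 < x < a}` and `A_1 = A_0 ∩ {y > 0}`. -/
def regionA (a b : ℝ) : Fin 2 → Set (ℝ × ℝ)
  | 0 => door a b ∪ {p | 0 < p.1 ∧ p.1 < a}
  | 1 => (door a b ∪ {p | 0 < p.1 ∧ p.1 < a}) ∩ {p | 0 < p.2}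

/-- The planar regions `B_0 = D ∪ {x > a}`, `B_1 = B_0 ∩ {y > 0}`, `B_2 = B_0 ∩ {y < b}` and
`B_3 = B_0 ∩ {0 < y < b}`. -/
def regionB (a b : ℝ) : Fin 4 → Set (ℝ × ℝ)
  | 0 => door a b ∪ {p | a < p.1}
  | 1 => (door a b ∪ {p | a < p.1}) ∩ {p | 0 < p.2}
  | 2 => (door a b ∪ {p | a < p.1}) ∩ {p | p.2 < b}
  | 3 => (door a b ∪ {p | a < p.1}) ∩ {p | 0 < p.2 ∧ p.2 < b}

/-- The planar corridor `C_ij = A_i ∪ B_j`. -/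
def planarCorridor (a b : ℝ) (i : Fin 2) (j : Fin 4) : Set (ℝ × ℝ) :=
  regionA a b i ∪ regionB a b j

/-- The cylinder `X × (0, c)` in three-space over a planar set `X`. -/
def cylinder (X : Set (ℝ × ℝ)) (c : ℝ) : Set Space :=
  {v | (v 0, v 1) ∈ X ∧ 0 < v 2 ∧ v 2 < c}

/-- The spatial corridor `S_ij = C_ij × (0, c)`. -/
def spatialCorridor (a b c : ℝ) (i : Fin 2) (j : Fin 4) : Set Space :=
  cylinder (planarCorridor a b i j) c

/-- The body `K` can move around the corner in the spatial corridor `S_ij`: there is a continuous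
path `Φ` of rigid motions of three-space such that `Φ 0` puts `K` into `A_i × (0, c)`, `Φ 1` puts
`K` into `B_j × (0, c)`, and every `Φ t` puts `K` into `S_ij`. (A path in the Euclidean group is
continuous if and only if each point moves continuously.) -/
def CanMoveAround (a b c : ℝ) (i : Fin 2) (j : Fin 4) (K : Set Space) : Prop :=
  ∃ Φ : unitInterval → (Space ≃ᵃⁱ[ℝ] Space),
    (∀ v : Space, Continuous fun t => Φ t v) ∧
    Φ 0 '' K ⊆ cylinder (regionA a b i) c ∧
    Φ 1 '' K ⊆ cylinder (regionB a b j) c ∧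
    ∀ t, Φ t '' K ⊆ spatialCorridor a b c i j

/-- The set of lengths of the (nondegenerate, open) line segments that can move around the corner
in the spatial corridor `S_ij`. -/
def movableLengths (a b c : ℝ) (i : Fin 2) (j : Fin 4) : Set ℝ :=
  {ℓ | 0 < ℓ ∧ ∃ p q : Space, dist p q = ℓ ∧ CanMoveAround a b c i j (openSegment ℝ p q)}

/-! Write `a = α ^ 3`, `b = β ^ 3` and consider projections to the plane. A spatial segment in the
corridor has vertical extent at most `c`, so if it exceeds the claimed supremum, the square of its
planar length stays above `(α ^ 2 + β ^ 2) ^ 3`. That planar length may vary during the motion, so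
the planar obstruction is stated for any continuous pair of endpoints staying that far apart.

The obstruction compares the slope with the critical value `β / α`, that of the longest ladder
turning the corner. A long segment that starts to cross the door from the left has width at most `a`
and must be steeper; one that has just finished crossing is bounded vertically by the door and must
be flatter. At the critical slope, a crossing segment has legs at most `α * (α ^ 2 + β ^ 2)` and `β
* (α ^ 2 + β ^ 2)`, hence is too short. Connectedness of the time interval then forbids the passage
(`no_crossing`, `no_long_crossing`). The heights and gaps are polynomials symmetric in the two
endpoints, so they stay continuous through vertical positions and do not depend on which end leads.

By inclusion of corridors, the upper bound is needed only for `S_11` and `S_03`, and the lower bound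
only for `S_13`, where a tilted ladder slides along two walls (`mem_movableLengths_of_sq_lt`). In
the other five corridors a steep segment of any length slides through the door along its own line
(`mem_movableLengths_of_slide`). -/

open Set

/-! ### Separation of the two sides of the door -/

/-- The height at which the line through `P` and `Q` meets the line `x = a`, multiplied by
`(Q.1 - P.1) ^ 2`. -/
def scaledHeight (a : ℝ) (P Q : ℝ × ℝ) : ℝ :=
  (P.2 * (Q.1 - a) + Q.2 * (a - P.1)) * (Q.1 - P.1)

/-- The line through `P` and `Q` meets the line `x = a` within the closed door (this also holds
if `P` and `Q` have the same abscissa). -/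
def MeetsDoor (a b : ℝ) (P Q : ℝ × ℝ) : Prop :=
  0 ≤ scaledHeight a P Q ∧ scaledHeight a P Q ≤ b * (Q.1 - P.1) ^ 2

/-- A moving pair of points cannot change from the left to the right of the line `x = a`, if a
continuous function `F` of the pair separates the states in which the pair starts to cross the
door from those in which it stops crossing. -/
theorem no_crossing {a b : ℝ} {P Q : unitInterval → ℝ × ℝ} (hP : Continuous P) (hQ : Continuous Q)
    {F : ℝ × ℝ → ℝ × ℝ → ℝ} (hF : Continuous fun t => F (P t) (Q t))
    (hwall : ∀ t, ¬ ((P t).1 = a ∧ (Q t).1 = a))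
    (hdoor : ∀ t, ((P t).1 - a) * ((Q t).1 - a) < 0 → MeetsDoor a b (P t) (Q t))
    (hleft : ∀ t, (P t).1 ≤ a → (Q t).1 ≤ a → ((P t).1 - a) * ((Q t).1 - a) = 0 →
      MeetsDoor a b (P t) (Q t) → 0 < F (P t) (Q t))
    (hright : ∀ t, a ≤ (P t).1 → a ≤ (Q t).1 → ((P t).1 - a) * ((Q t).1 - a) = 0 →
      MeetsDoor a b (P t) (Q t) → F (P t) (Q t) < 0)
    (hcross : ∀ t, ((P t).1 - a) * ((Q t).1 - a) < 0 → F (P t) (Q t) ≠ 0)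
    (h0 : (P 0).1 ≤ a ∧ (Q 0).1 ≤ a) (h1 : a ≤ (P 1).1 ∧ a ≤ (Q 1).1) : False := by
  have hdc : IsClosed {t | MeetsDoor a b (P t) (Q t)} := by
    have h1 : IsClosed {t | 0 ≤ scaledHeight a (P t) (Q t)} := by
      unfold scaledHeight
      exact isClosed_le (by fun_prop) (by fun_prop)
    have h2 : IsClosed {t | scaledHeight a (P t) (Q t) ≤ b * ((Q t).1 - (P t).1) ^ 2} := by
      unfold scaledHeight
      exact isClosed_le (by fun_prop) (by fun_prop)
    exact h1.inter h2
  have hpc : IsClosed {t | ((P t).1 - a) * ((Q t).1 - a) ≤ 0} :=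
    isClosed_le (by fun_prop) (by fun_prop)
  have hside {f : unitInterval → ℝ × ℝ} (hf : Continuous f) :
      IsClosed {t | (f t).1 ≤ a} ∧ IsClosed {t | a ≤ (f t).1} :=
    ⟨isClosed_le (by fun_prop) (by fun_prop), isClosed_le (by fun_prop) (by fun_prop)⟩
  -- Crossing states with nonnegative gap are joined to the left states, those with nonpositive gap
  -- to the right states. The two closed sets cover the interval; a common time would violate one of
  -- the hypotheses on the wall or on `F`.
  have hX : IsClosed ({t | (P t).1 ≤ a ∧ (Q t).1 ≤ a} ∪
      ({t | ((P t).1 - a) * ((Q t).1 - a) ≤ 0} ∩ {t | MeetsDoor a b (P t) (Q t)} ∩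
        {t | 0 ≤ F (P t) (Q t)})) :=
    ((hside hP).1.inter (hside hQ).1).union
      ((hpc.inter hdc).inter (isClosed_le continuous_const hF))
  have hY : IsClosed ({t | a ≤ (P t).1 ∧ a ≤ (Q t).1} ∪
      ({t | ((P t).1 - a) * ((Q t).1 - a) ≤ 0} ∩ {t | MeetsDoor a b (P t) (Q t)} ∩
        {t | F (P t) (Q t) ≤ 0})) :=
    ((hside hP).2.inter (hside hQ).2).union
      ((hpc.inter hdc).inter (isClosed_le hF continuous_const))
  obtain ⟨t, -, ht1, ht2⟩ := isPreconnected_closed_iff.1 (isPreconnected_univ (α := unitInterval))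
    _ _ hX hY
    (by
      intro t _
      by_cases hc : ((P t).1 - a) * ((Q t).1 - a) < 0
      · rcases le_total 0 (F (P t) (Q t)) with h | h
        · exact Or.inl (Or.inr ⟨⟨hc.le, hdoor t hc⟩, h⟩)
        · exact Or.inr (Or.inr ⟨⟨hc.le, hdoor t hc⟩, h⟩)
      · rcases le_total (P t).1 a with hp | hp
        · rcases le_or_gt (Q t).1 a with hq | hq
          · exact Or.inl (Or.inl ⟨hp, hq⟩)
          · rcases hp.eq_or_lt with hp | hp
            · exact Or.inr (Or.inl ⟨hp.ge, hq.le⟩)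
            · exact absurd (mul_neg_of_neg_of_pos (sub_neg.2 hp) (sub_pos.2 hq)) hc
        · rcases le_or_gt a (Q t).1 with hq | hq
          · exact Or.inr (Or.inl ⟨hp, hq⟩)
          · rcases hp.eq_or_lt with hp | hp
            · exact Or.inl (Or.inl ⟨hp.ge, hq.le⟩)
            · exact absurd (mul_neg_of_pos_of_neg (sub_pos.2 hp) (sub_neg.2 hq)) hc)
    ⟨0, trivial, Or.inl h0⟩ ⟨1, trivial, Or.inl h1⟩
  rcases ht1 with ⟨hp, hq⟩ | ⟨⟨hc, hd⟩, hF1⟩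
  · rcases ht2 with ⟨hp', hq'⟩ | ⟨⟨hc, hd⟩, hF2⟩
    · exact hwall t ⟨hp.antisymm hp', hq.antisymm hq'⟩
    · exact absurd (hleft t hp hq (le_antisymm hc
        (mul_nonneg_of_nonpos_of_nonpos (sub_nonpos.2 hp) (sub_nonpos.2 hq))) hd) (not_lt.2 hF2)
  · rcases ht2 with ⟨hp', hq'⟩ | ⟨-, hF2⟩
    · exact absurd (hright t hp' hq' (le_antisymm hc
        (mul_nonneg (sub_nonneg.2 hp') (sub_nonneg.2 hq'))) hd) (not_lt.2 hF1)
    · have hF0 : F (P t) (Q t) = 0 := le_antisymm hF2 hF1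
      rcases lt_or_eq_of_le (show ((P t).1 - a) * ((Q t).1 - a) ≤ 0 from hc) with hc | hc
      · exact hcross t hc hF0
      · rcases mul_eq_zero.1 hc with h | h
        · have h := sub_eq_zero.1 h
          rcases le_total (Q t).1 a with hq | hq
          · exact (hleft t h.le hq hc hd).ne' hF0
          · exact (hright t h.ge hq hc hd).ne hF0
        · have h := sub_eq_zero.1 h
          rcases le_total (P t).1 a with hp | hp
          · exact (hleft t hp h.le hc hd).ne' hF0
          · exact (hright t hp h.ge hc hd).ne hF0

/-! ### Segments and their endpoints -/

/-- Only the open segment is confined, so its endpoints inherit the constraints by closure, as weak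
inequalities. -/
theorem endpoints_nonneg {u v : ℝ} (h : ∀ s, 0 < s → s < 1 → 0 ≤ (1 - s) * u + s * v) :
    0 ≤ u ∧ 0 ≤ v := by
  have hcl : IsClosed {s : ℝ | 0 ≤ (1 - s) * u + s * v} :=
    isClosed_le (by fun_prop) (by fun_prop)
  have hsub : Icc (0 : ℝ) 1 ⊆ {s : ℝ | 0 ≤ (1 - s) * u + s * v} := by
    rw [← closure_Ioo (zero_ne_one' ℝ)]
    exact closure_minimal (fun s hs => h s hs.1 hs.2) hcl
  have h0 := hsub (left_mem_Icc.2 zero_le_one)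
  have h1 := hsub (right_mem_Icc.2 zero_le_one)
  simp only [mem_ofPred_eq] at h0 h1
  constructor <;> linarith

theorem endpoints_le {u v m : ℝ} (h : ∀ s, 0 < s → s < 1 → (1 - s) * u + s * v ≤ m) :
    u ≤ m ∧ v ≤ m := by
  have := endpoints_nonneg (u := m - u) (v := m - v)
    fun s h0 h1 => by linarith [h s h0 h1]
  constructor <;> linarith [this.1, this.2]

theorem endpoints_ge {u v m : ℝ} (h : ∀ s, 0 < s → s < 1 → m ≤ (1 - s) * u + s * v) :
    m ≤ u ∧ m ≤ v := by
  have := endpoints_nonneg (u := u - m) (v := v - m)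
    fun s h0 h1 => by linarith [h s h0 h1]
  constructor <;> linarith [this.1, this.2]

/-- The point dividing the segment from `P` to `Q` in the ratio `s : 1 - s` has the property `R`,
for every `s` strictly between `0` and `1`. -/
def OnSegment (R : ℝ → ℝ → Prop) (P Q : ℝ × ℝ) : Prop :=
  ∀ s, 0 < s → s < 1 → R ((1 - s) * P.1 + s * Q.1) ((1 - s) * P.2 + s * Q.2)

theorem OnSegment.symm {R : ℝ → ℝ → Prop} {P Q : ℝ × ℝ} (h : OnSegment R P Q) :
    OnSegment R Q P := fun s h0 h1 => by
  have := h (1 - s) (by linarith) (by linarith)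
  rwa [sub_sub_cancel, add_comm, add_comm (s * P.2)] at this

theorem OnSegment.mono {R R' : ℝ → ℝ → Prop} (hR : ∀ x y, R x y → R' x y) {P Q : ℝ × ℝ}
    (h : OnSegment R P Q) : OnSegment R' P Q := fun s h0 h1 => hR _ _ (h s h0 h1)

theorem scaledHeight_comm (a : ℝ) (P Q : ℝ × ℝ) : scaledHeight a P Q = scaledHeight a Q P := by
  unfold scaledHeight; ring

theorem MeetsDoor.symm {a b : ℝ} {P Q : ℝ × ℝ} (h : MeetsDoor a b P Q) : MeetsDoor a b Q P := by
  unfold MeetsDoor at *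
  rw [scaledHeight_comm a Q P]
  exact ⟨h.1, h.2.trans_eq (by ring)⟩

/-- A segment that crosses the line `x = a` does so at a point of the door. -/
theorem OnSegment.exists_height {a b : ℝ} {P Q : ℝ × ℝ}
    (h : OnSegment (fun x y => x = a → 0 < y ∧ y < b) P Q) (hP : P.1 < a) (hQ : a < Q.1) :
    ∃ y, 0 < y ∧ y < b ∧ P.2 * (Q.1 - a) + Q.2 * (a - P.1) = y * (Q.1 - P.1) := by
  have hw : 0 < Q.1 - P.1 := by linarith
  have := h ((a - P.1) / (Q.1 - P.1)) (div_pos (by linarith) hw)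
    ((div_lt_one hw).2 (by linarith)) (by field_simp; ring)
  refine ⟨_, this.1, this.2, ?_⟩
  field_simp
  ring

theorem OnSegment.meetsDoor {a b : ℝ} {P Q : ℝ × ℝ}
    (h : OnSegment (fun x y => x = a → 0 < y ∧ y < b) P Q)
    (hPQ : (P.1 - a) * (Q.1 - a) < 0) : MeetsDoor a b P Q := by
  wlog hlt : P.1 < a generalizing P Q
  · refine (this h.symm (by linarith) ?_).symm
    by_contra hq
    exact absurd hPQ (not_lt.2 (mul_nonneg (by linarith) (by linarith)))
  have hQ : a < Q.1 := by
    by_contra hq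
    exact absurd hPQ (not_lt.2 (mul_nonneg_of_nonpos_of_nonpos (by linarith) (by linarith)))
  obtain ⟨y, h0, h1, hy⟩ := h.exists_height hlt hQ
  unfold MeetsDoor scaledHeight
  rw [hy]
  constructor
  · nlinarith [mul_pos h0 (pow_pos (sub_pos.2 (hlt.trans hQ)) 2)]
  · nlinarith [mul_pos (sub_pos.2 h1) (pow_pos (sub_pos.2 (hlt.trans hQ)) 2)]

/-- A segment inside the line `x = a` lies in the door, so its length is at most `b`. -/
theorem OnSegment.not_vertical {a b : ℝ} {P Q : ℝ × ℝ}
    (h : OnSegment (fun x y => x = a → 0 < y ∧ y < b) P Q)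
    (hlen : b ^ 2 < (Q.1 - P.1) ^ 2 + (Q.2 - P.2) ^ 2) : ¬ (P.1 = a ∧ Q.1 = a) := by
  rintro ⟨hP, hQ⟩
  have h' : ∀ s, 0 < s → s < 1 → 0 < (1 - s) * P.2 + s * Q.2 ∧ (1 - s) * P.2 + s * Q.2 < b :=
    fun s h0 h1 => h s h0 h1 (by rw [hP, hQ]; ring)
  have hlo := endpoints_nonneg fun s h0 h1 => (h' s h0 h1).1.le
  have hhi := endpoints_le fun s h0 h1 => (h' s h0 h1).2.le
  rw [hP, hQ] at hlen
  have : |Q.2 - P.2| ≤ b := abs_le.2 ⟨by linarith [hlo.2, hhi.1], by linarith [hlo.1, hhi.2]⟩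
  have := sq_le_sq' (by linarith [(abs_le.1 this).1]) (abs_le.1 this).2
  linarith

/-! ### Planar bounds -/

/-- The two bounds are the intercepts of the line of slope `-β / α` through the corner `(α ^ 3, β ^
3)`, that is, the legs of the critical ladder. -/
theorem sq_add_sq_le_of_critical {α β w u : ℝ}
    (hw : |w| ≤ α * (α ^ 2 + β ^ 2)) (hu : |u| ≤ β * (α ^ 2 + β ^ 2)) :
    w ^ 2 + u ^ 2 ≤ (α ^ 2 + β ^ 2) ^ 3 := by
  have h1 := sq_le_sq' (by linarith [(abs_le.1 hw).1]) (abs_le.1 hw).2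
  have h2 := sq_le_sq' (by linarith [(abs_le.1 hu).1]) (abs_le.1 hu).2
  linarith [show (α * (α ^ 2 + β ^ 2)) ^ 2 + (β * (α ^ 2 + β ^ 2)) ^ 2 = (α ^ 2 + β ^ 2) ^ 3 by ring]

theorem sq_le_critical {α β : ℝ} : (β ^ 3) ^ 2 ≤ (α ^ 2 + β ^ 2) ^ 3 := by
  have h : β ^ 2 ≤ α ^ 2 + β ^ 2 := by linarith [sq_nonneg α]
  calc (β ^ 3) ^ 2 = (β ^ 2) ^ 3 := by ring
    _ ≤ _ := pow_le_pow_left₀ (sq_nonneg β) h 3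

/-! ### Slope gap for the corridor `S_11` -/

section Quadrant

/-- The quadrant `x > 0`, `y > 0` without the half-line `x = a`, `y ≥ b`. -/
def InQuadrant (a b x y : ℝ) : Prop := 0 < x ∧ 0 < y ∧ (x = a → y < b)

variable {α β : ℝ} {P Q : ℝ × ℝ}

/-- This is positive if the segment is decreasing and steeper than the critical slope. -/
def quadrantGap (α β : ℝ) (P Q : ℝ × ℝ) : ℝ :=
  α * ((P.2 - Q.2) * (Q.1 - P.1)) - β * (Q.1 - P.1) ^ 2

theorem quadrantGap_comm : quadrantGap α β P Q = quadrantGap α β Q P := by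
  unfold quadrantGap; ring

theorem OnSegment.quadrant_nonneg {a b : ℝ} (h : OnSegment (InQuadrant a b) P Q) :
    (0 ≤ P.1 ∧ 0 ≤ Q.1) ∧ 0 ≤ P.2 ∧ 0 ≤ Q.2 :=
  ⟨endpoints_nonneg fun s h0 h1 => (h s h0 h1).1.le,
    endpoints_nonneg fun s h0 h1 => (h s h0 h1).2.1.le⟩

/-- The width is at most `α ^ 3`, and the right end is at height at most `β ^ 3`, which bounds any
rise. If the descent were not steeper than critical, the drop would be at most `β * α ^ 2`, and the
segment would be too short. -/
theorem quadrant_left (hα : 0 < α) (hβ : 0 < β) (h : OnSegment (InQuadrant (α ^ 3) (β ^ 3)) P Q)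
    (hlen : (α ^ 2 + β ^ 2) ^ 3 < (Q.1 - P.1) ^ 2 + (Q.2 - P.2) ^ 2)
    (hPQ : P.1 < Q.1) (hQ : Q.1 = α ^ 3) (hd : MeetsDoor (α ^ 3) (β ^ 3) P Q) :
    0 < quadrantGap α β P Q := by
  by_contra hF
  obtain ⟨⟨hP1, -⟩, hP2, hQ2⟩ := h.quadrant_nonneg
  have hw : 0 < Q.1 - P.1 := sub_pos.2 hPQ
  have hQb : Q.2 ≤ β ^ 3 := by
    have := hd.2
    unfold scaledHeight at this
    rw [← hQ] at this
    exact le_of_mul_le_mul_right (by linarith) (pow_pos hw 2)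
  have hu : α * (P.2 - Q.2) ≤ β * (Q.1 - P.1) := by
    unfold quadrantGap at hF
    exact le_of_mul_le_mul_right (by linarith) hw
  have hu' : P.2 - Q.2 ≤ β * α ^ 2 := by
    have : β * (Q.1 - P.1) ≤ β * α ^ 3 := by gcongr; linarith
    exact le_of_mul_le_mul_left (by linarith) hα
  have := sq_add_sq_le_of_critical (α := α) (β := β) (w := Q.1 - P.1) (u := Q.2 - P.2)
    (abs_le.2 ⟨by nlinarith [pow_pos hα 3, mul_pos hα (pow_pos hβ 2)],
      by nlinarith [pow_pos hα 3, mul_pos hα (pow_pos hβ 2)]⟩)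
    (abs_le.2 ⟨by nlinarith [pow_pos hβ 3, mul_pos hβ (pow_pos hα 2)],
      by nlinarith [pow_pos hβ 3, mul_pos hβ (pow_pos hα 2)]⟩)
  linarith

/-- The left end is at height at most `β ^ 3`, so the drop is bounded by `β ^ 3`. A descent at least
as steep as critical would limit the width to `α * β ^ 2`. Rising segments have negative gap anyway.
-/
theorem quadrant_right (hα : 0 < α) (hβ : 0 < β) (h : OnSegment (InQuadrant (α ^ 3) (β ^ 3)) P Q)
    (hlen : (α ^ 2 + β ^ 2) ^ 3 < (Q.1 - P.1) ^ 2 + (Q.2 - P.2) ^ 2)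
    (hPQ : P.1 < Q.1) (hP : P.1 = α ^ 3) (hd : MeetsDoor (α ^ 3) (β ^ 3) P Q) :
    quadrantGap α β P Q < 0 := by
  by_contra hF
  obtain ⟨-, hP2, hQ2⟩ := h.quadrant_nonneg
  have hw : 0 < Q.1 - P.1 := sub_pos.2 hPQ
  have hPb : P.2 ≤ β ^ 3 := by
    have := hd.2
    unfold scaledHeight at this
    rw [← hP] at this
    exact le_of_mul_le_mul_right (by linarith) (pow_pos hw 2)
  have hu : β * (Q.1 - P.1) ≤ α * (P.2 - Q.2) := by
    unfold quadrantGap at hF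
    exact le_of_mul_le_mul_right (by linarith) hw
  have hw' : Q.1 - P.1 ≤ α * β ^ 2 := by
    have : α * (P.2 - Q.2) ≤ α * β ^ 3 := by gcongr; linarith
    exact le_of_mul_le_mul_left (by linarith) hβ
  have hu0 : 0 ≤ P.2 - Q.2 := by
    by_contra hn
    nlinarith [mul_pos hβ hw, mul_neg_of_pos_of_neg hα (not_le.1 hn)]
  have := sq_add_sq_le_of_critical (α := α) (β := β) (w := Q.1 - P.1) (u := Q.2 - P.2)
    (abs_le.2 ⟨by nlinarith [pow_pos hα 3, mul_pos hα (pow_pos hβ 2)],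
      by nlinarith [pow_pos hα 3, mul_pos hα (pow_pos hβ 2)]⟩)
    (abs_le.2 ⟨by nlinarith [pow_pos hβ 3, mul_pos hβ (pow_pos hα 2)],
      by nlinarith [pow_pos hβ 3, mul_pos hβ (pow_pos hα 2)]⟩)
  linarith

/-- The wall cuts the segment in two. The left part has width at most `α ^ 3`; the right part drops
by at most `β ^ 3`, so at the critical slope its width is at most `α * β ^ 2`. -/
theorem quadrant_cross (hα : 0 < α) (hβ : 0 < β) (h : OnSegment (InQuadrant (α ^ 3) (β ^ 3)) P Q)
    (hlen : (α ^ 2 + β ^ 2) ^ 3 < (Q.1 - P.1) ^ 2 + (Q.2 - P.2) ^ 2)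
    (hP : P.1 < α ^ 3) (hQ : α ^ 3 < Q.1) : quadrantGap α β P Q ≠ 0 := by
  intro hF
  obtain ⟨⟨hP1, -⟩, hP2, hQ2⟩ := h.quadrant_nonneg
  have hw : 0 < Q.1 - P.1 := by linarith
  obtain ⟨y, -, hyb, hy⟩ := (h.mono fun x y hxy e => ⟨hxy.2.1, hxy.2.2 e⟩ :
    OnSegment (fun x y => x = α ^ 3 → 0 < y ∧ y < β ^ 3) P Q).exists_height hP hQ
  have hu : α * (P.2 - Q.2) = β * (Q.1 - P.1) := by
    unfold quadrantGap at hF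
    exact mul_right_cancel₀ hw.ne' (by linarith)
  have hQy : β * (Q.1 - α ^ 3) = α * (y - Q.2) := by
    refine mul_right_cancel₀ hw.ne' ?_
    linear_combination α * hy - (Q.1 - α ^ 3) * hu
  have hQ' : Q.1 - α ^ 3 ≤ α * β ^ 2 := by
    have : α * (y - Q.2) ≤ α * β ^ 3 := by gcongr; linarith
    exact le_of_mul_le_mul_left (by linarith) hβ
  have hw' : Q.1 - P.1 ≤ α * (α ^ 2 + β ^ 2) := by linarith
  have hu' : P.2 - Q.2 ≤ β * (α ^ 2 + β ^ 2) := by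
    have : β * (Q.1 - P.1) ≤ β * (α * (α ^ 2 + β ^ 2)) := by gcongr
    exact le_of_mul_le_mul_left (by linarith) hα
  have hu0 : 0 ≤ P.2 - Q.2 := le_of_mul_le_mul_left (by linarith [mul_pos hβ hw]) hα
  have := sq_add_sq_le_of_critical (α := α) (β := β) (w := Q.1 - P.1) (u := Q.2 - P.2)
    (abs_le.2 ⟨by linarith, hw'⟩) (abs_le.2 ⟨by linarith, by linarith⟩)
  linarith

end Quadrant

/-! ### Slope gap for the corridor `S_03` -/

section HalfStrip

/-- The half-plane `x > 0` without the points with `x ≥ a` that are outside `0 < y < b`. -/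
def InHalfStrip (a b x y : ℝ) : Prop := 0 < x ∧ (a ≤ x → 0 < y ∧ y < b)

variable {α β : ℝ} {P Q : ℝ × ℝ}

/-- This is positive if the segment is steeper than the critical slope. -/
def halfStripGap (α β : ℝ) (P Q : ℝ × ℝ) : ℝ :=
  (α * (Q.2 - P.2)) ^ 2 - (β * (Q.1 - P.1)) ^ 2

theorem halfStripGap_comm : halfStripGap α β P Q = halfStripGap α β Q P := by
  unfold halfStripGap; ring

theorem OnSegment.halfStrip_nonneg {a b : ℝ} (h : OnSegment (InHalfStrip a b) P Q) :
    0 ≤ P.1 ∧ 0 ≤ Q.1 := endpoints_nonneg fun s h0 h1 => (h s h0 h1).1.le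

/-- Both signs of the slope are possible here, hence the squared gap. Width at most `α ^ 3` with a
slope not above critical would give vertical extent at most `β * α ^ 2`. -/
theorem halfStrip_left (hα : 0 < α) (hβ : 0 < β)
    (h : OnSegment (InHalfStrip (α ^ 3) (β ^ 3)) P Q)
    (hlen : (α ^ 2 + β ^ 2) ^ 3 < (Q.1 - P.1) ^ 2 + (Q.2 - P.2) ^ 2)
    (hPQ : P.1 < Q.1) (hQ : Q.1 = α ^ 3) : 0 < halfStripGap α β P Q := by
  by_contra hF
  have hP1 := h.halfStrip_nonneg.1
  have hw : 0 < Q.1 - P.1 := sub_pos.2 hPQ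
  have hu := abs_le_of_sq_le_sq (sub_nonpos.1 (not_lt.1 hF)) (by positivity)
  rw [abs_mul, abs_of_pos hα] at hu
  have hu' : |Q.2 - P.2| ≤ β * α ^ 2 := by
    have : β * (Q.1 - P.1) ≤ β * α ^ 3 := by gcongr; linarith
    exact le_of_mul_le_mul_left (by linarith) hα
  have := sq_add_sq_le_of_critical (α := α) (β := β) (w := Q.1 - P.1) (u := Q.2 - P.2)
    (abs_le.2 ⟨by nlinarith [pow_pos hα 3, mul_pos hα (pow_pos hβ 2)],
      by nlinarith [pow_pos hα 3, mul_pos hα (pow_pos hβ 2)]⟩)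
    (by nlinarith [pow_pos hβ 3, mul_pos hβ (pow_pos hα 2)])
  linarith

/-- The whole segment lies in `0 < y < β ^ 3`, so a slope not below critical would give width at
most `α * β ^ 2`. -/
theorem halfStrip_right (hα : 0 < α) (hβ : 0 < β)
    (h : OnSegment (InHalfStrip (α ^ 3) (β ^ 3)) P Q)
    (hlen : (α ^ 2 + β ^ 2) ^ 3 < (Q.1 - P.1) ^ 2 + (Q.2 - P.2) ^ 2)
    (hPQ : P.1 < Q.1) (hP : P.1 = α ^ 3) : halfStripGap α β P Q < 0 := by
  by_contra hF
  have hw : 0 < Q.1 - P.1 := sub_pos.2 hPQ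
  have hy s (h0 : 0 < s) (h1 : s < 1) := (h s h0 h1).2 (by nlinarith [mul_pos h0 hw])
  have hlo := endpoints_nonneg fun s h0 h1 => (hy s h0 h1).1.le
  have hhi := endpoints_le fun s h0 h1 => (hy s h0 h1).2.le
  have hu : |Q.2 - P.2| ≤ β ^ 3 :=
    abs_le.2 ⟨by linarith [hlo.2, hhi.1], by linarith [hlo.1, hhi.2]⟩
  have hF' := sq_le_sq.1 (sub_nonneg.1 (not_lt.1 hF))
  rw [abs_mul, abs_mul, abs_of_pos hα, abs_of_pos hβ, abs_of_pos hw] at hF'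
  have hw' : Q.1 - P.1 ≤ α * β ^ 2 := by
    have : α * |Q.2 - P.2| ≤ α * β ^ 3 := by gcongr
    exact le_of_mul_le_mul_left (by linarith) hβ
  have := sq_add_sq_le_of_critical (α := α) (β := β) (w := Q.1 - P.1) (u := Q.2 - P.2)
    (abs_le.2 ⟨by nlinarith [pow_pos hα 3, mul_pos hα (pow_pos hβ 2)],
      by nlinarith [pow_pos hα 3, mul_pos hα (pow_pos hβ 2)]⟩)
    (by nlinarith [pow_pos hβ 3, mul_pos hβ (pow_pos hα 2)])
  linarith

theorem halfStrip_cross (hα : 0 < α) (hβ : 0 < β)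
    (h : OnSegment (InHalfStrip (α ^ 3) (β ^ 3)) P Q)
    (hlen : (α ^ 2 + β ^ 2) ^ 3 < (Q.1 - P.1) ^ 2 + (Q.2 - P.2) ^ 2)
    (hP : P.1 < α ^ 3) (hQ : α ^ 3 < Q.1) : halfStripGap α β P Q ≠ 0 := by
  intro hF
  have hP1 := h.halfStrip_nonneg.1
  have hw : 0 < Q.1 - P.1 := by linarith
  obtain ⟨y, -, -, hy⟩ := (h.mono fun x y hxy e => hxy.2 e.ge :
    OnSegment (fun x y => x = α ^ 3 → 0 < y ∧ y < β ^ 3) P Q).exists_height hP hQ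
  -- The part to the right of the wall, from the crossing point `(α ^ 3, y)` to `Q`, is
  -- reparametrised over `(0, 1)`; it stays in the horizontal strip, so its vertical extent is at
  -- most `β ^ 3`.
  have htail s (h0 : 0 < s) (h1 : s < 1) :
      0 < (1 - s) * y + s * Q.2 ∧ (1 - s) * y + s * Q.2 < β ^ 3 := by
    have hy' : y = (P.2 * (Q.1 - α ^ 3) + Q.2 * (α ^ 3 - P.1)) / (Q.1 - P.1) := by
      rw [hy, mul_div_cancel_right₀ _ hw.ne']
    have hr0 : 0 < (α ^ 3 - P.1 + s * (Q.1 - α ^ 3)) / (Q.1 - P.1) :=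
      div_pos (add_pos (sub_pos.2 hP) (mul_pos h0 (sub_pos.2 hQ))) hw
    have hr1 : (α ^ 3 - P.1 + s * (Q.1 - α ^ 3)) / (Q.1 - P.1) < 1 :=
      (div_lt_one hw).2 (by nlinarith)
    have hx : (1 - (α ^ 3 - P.1 + s * (Q.1 - α ^ 3)) / (Q.1 - P.1)) * P.1 +
        (α ^ 3 - P.1 + s * (Q.1 - α ^ 3)) / (Q.1 - P.1) * Q.1 = α ^ 3 + s * (Q.1 - α ^ 3) := by
      field_simp; ring
    have := (h _ hr0 hr1).2 (by rw [hx]; nlinarith)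
    convert this using 2 <;> (rw [hy']; field_simp; ring)
  have hlo := endpoints_nonneg fun s h0 h1 => (htail s h0 h1).1.le
  have hhi := endpoints_le fun s h0 h1 => (htail s h0 h1).2.le
  have hu : |Q.2 - y| ≤ β ^ 3 :=
    abs_le.2 ⟨by linarith [hlo.2, hhi.1], by linarith [hlo.1, hhi.2]⟩
  have hF' := (sq_eq_sq_iff_abs_eq_abs _ _).1 (sub_eq_zero.1 hF)
  rw [abs_mul, abs_mul, abs_of_pos hα, abs_of_pos hβ, abs_of_pos hw] at hF'
  -- Similar triangles: the right part has the same slope as the whole segment.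
  have hsim : |Q.2 - y| * (Q.1 - P.1) = |Q.2 - P.2| * (Q.1 - α ^ 3) := by
    have e : (Q.2 - y) * (Q.1 - P.1) = (Q.2 - P.2) * (Q.1 - α ^ 3) := by linear_combination hy
    have := congrArg abs e
    rwa [abs_mul, abs_mul, abs_of_pos hw, abs_of_pos (sub_pos.2 hQ)] at this
  have hQy : β * (Q.1 - α ^ 3) = α * |Q.2 - y| := by
    refine mul_right_cancel₀ hw.ne' ?_
    linear_combination -α * hsim - (Q.1 - α ^ 3) * hF'
  have hQ' : Q.1 - α ^ 3 ≤ α * β ^ 2 := by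
    have : α * |Q.2 - y| ≤ α * β ^ 3 := by gcongr
    exact le_of_mul_le_mul_left (by linarith) hβ
  have hw' : Q.1 - P.1 ≤ α * (α ^ 2 + β ^ 2) := by linarith
  have hu' : |Q.2 - P.2| ≤ β * (α ^ 2 + β ^ 2) := by
    have : β * (Q.1 - P.1) ≤ β * (α * (α ^ 2 + β ^ 2)) := by gcongr
    exact le_of_mul_le_mul_left (by linarith) hα
  have := sq_add_sq_le_of_critical (α := α) (β := β) (w := Q.1 - P.1) (u := Q.2 - P.2)
    (abs_le.2 ⟨by linarith, hw'⟩) hu'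
  linarith

end HalfStrip

/-- If the relation `R` and the gap function `F` satisfy the three separation conditions for pairs
of points in which the first is to the left of the second, then a segment that stays in `R` and
stays longer than the critical length cannot pass through the door. -/
theorem no_long_crossing {α β : ℝ} {R : ℝ → ℝ → Prop} {F : ℝ × ℝ → ℝ × ℝ → ℝ}
    (hR : ∀ x y, R x y → x = α ^ 3 → 0 < y ∧ y < β ^ 3)
    (hcomm : ∀ P Q, F P Q = F Q P)
    (hleft : ∀ P Q : ℝ × ℝ, OnSegment R P Q →
      (α ^ 2 + β ^ 2) ^ 3 < (Q.1 - P.1) ^ 2 + (Q.2 - P.2) ^ 2 →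
      P.1 < Q.1 → Q.1 = α ^ 3 → MeetsDoor (α ^ 3) (β ^ 3) P Q → 0 < F P Q)
    (hright : ∀ P Q : ℝ × ℝ, OnSegment R P Q →
      (α ^ 2 + β ^ 2) ^ 3 < (Q.1 - P.1) ^ 2 + (Q.2 - P.2) ^ 2 →
      P.1 < Q.1 → P.1 = α ^ 3 → MeetsDoor (α ^ 3) (β ^ 3) P Q → F P Q < 0)
    (hcross : ∀ P Q : ℝ × ℝ, OnSegment R P Q →
      (α ^ 2 + β ^ 2) ^ 3 < (Q.1 - P.1) ^ 2 + (Q.2 - P.2) ^ 2 →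
      P.1 < α ^ 3 → α ^ 3 < Q.1 → F P Q ≠ 0)
    {P Q : unitInterval → ℝ × ℝ} (hP : Continuous P) (hQ : Continuous Q)
    (hF : Continuous fun t => F (P t) (Q t))
    (hseg : ∀ t, OnSegment R (P t) (Q t))
    (hlen : ∀ t, (α ^ 2 + β ^ 2) ^ 3 < ((Q t).1 - (P t).1) ^ 2 + ((Q t).2 - (P t).2) ^ 2)
    (h0 : (P 0).1 ≤ α ^ 3 ∧ (Q 0).1 ≤ α ^ 3) (h1 : α ^ 3 ≤ (P 1).1 ∧ α ^ 3 ≤ (Q 1).1) :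
    False := by
  have hlen' : ∀ t, (α ^ 2 + β ^ 2) ^ 3 < ((P t).1 - (Q t).1) ^ 2 + ((P t).2 - (Q t).2) ^ 2 :=
    fun t => (hlen t).trans_eq (by ring)
  have hnv : ∀ t, ¬ ((P t).1 = α ^ 3 ∧ (Q t).1 = α ^ 3) := fun t =>
    ((hseg t).mono hR).not_vertical (sq_le_critical.trans_lt (hlen t))
  refine no_crossing hP hQ hF hnv (fun t ht => ((hseg t).mono hR).meetsDoor ht)
    (fun t hp hq hpq hd => ?_) (fun t hp hq hpq hd => ?_) (fun t ht => ?_) h0 h1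
  · rcases mul_eq_zero.1 hpq with e | e
    · have e := sub_eq_zero.1 e
      rw [hcomm]
      exact hleft _ _ (hseg t).symm (hlen' t)
        (e ▸ hq.lt_of_ne fun e' => hnv t ⟨e, e'⟩) e hd.symm
    · have e := sub_eq_zero.1 e
      exact hleft _ _ (hseg t) (hlen t) (e ▸ hp.lt_of_ne fun e' => hnv t ⟨e', e⟩) e hd
  · rcases mul_eq_zero.1 hpq with e | e
    · have e := sub_eq_zero.1 e
      exact hright _ _ (hseg t) (hlen t) (e ▸ hq.lt_of_ne fun e' => hnv t ⟨e, e'.symm⟩) e hd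
    · have e := sub_eq_zero.1 e
      rw [hcomm]
      exact hright _ _ (hseg t).symm (hlen' t)
        (e ▸ hp.lt_of_ne fun e' => hnv t ⟨e'.symm, e⟩) e hd.symm
  · rcases mul_neg_iff.1 ht with ⟨hp, hq⟩ | ⟨hp, hq⟩
    · rw [hcomm]
      exact hcross _ _ (hseg t).symm (hlen' t) (sub_neg.1 hq) (sub_pos.1 hp)
    · exact hcross _ _ (hseg t) (hlen t) (sub_neg.1 hp) (sub_pos.1 hq)

/-! ### The upper bound in space -/

theorem mem_planarCorridor_quadrant {a b x y : ℝ} (ha : 0 < a)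
    (h : (x, y) ∈ planarCorridor a b 1 1) : InQuadrant a b x y := by
  simp only [planarCorridor, regionA, regionB, door, mem_union, mem_inter_iff,
    mem_ofPred_eq] at h
  unfold InQuadrant
  rcases h with ⟨h | h, hy⟩ | ⟨h | h, hy⟩
  · exact ⟨h.1 ▸ ha, hy, fun _ => h.2.2⟩
  · exact ⟨h.1, hy, fun e => absurd e h.2.ne⟩
  · exact ⟨h.1 ▸ ha, hy, fun _ => h.2.2⟩
  · exact ⟨ha.trans h, hy, fun e => absurd e h.ne'⟩

theorem mem_planarCorridor_halfStrip {a b x y : ℝ} (ha : 0 < a)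
    (h : (x, y) ∈ planarCorridor a b 0 3) : InHalfStrip a b x y := by
  simp only [planarCorridor, regionA, regionB, door, mem_union, mem_inter_iff,
    mem_ofPred_eq] at h
  unfold InHalfStrip
  rcases h with (h | h) | ⟨h | h, hy⟩
  · exact ⟨h.1 ▸ ha, fun _ => h.2⟩
  · exact ⟨h.1, fun e => absurd e h.2.not_ge⟩
  · exact ⟨h.1 ▸ ha, fun _ => h.2⟩
  · exact ⟨ha.trans h, fun _ => hy⟩

theorem regionA_le {a b : ℝ} {i : Fin 2} {p : ℝ × ℝ} (h : p ∈ regionA a b i) : p.1 ≤ a := by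
  fin_cases i <;>
    simp only [regionA, door, mem_union, mem_inter_iff, mem_ofPred_eq] at h
  · rcases h with h | h <;> linarith [h.1, h.2]
  · rcases h with ⟨h | h, -⟩ <;> linarith [h.1, h.2]

theorem le_regionB {a b : ℝ} {j : Fin 4} {p : ℝ × ℝ} (h : p ∈ regionB a b j) : a ≤ p.1 := by
  fin_cases j <;>
    simp only [regionB, door, mem_union, mem_inter_iff, mem_ofPred_eq] at h
  · exact h.elim (fun h => h.1.ge) le_of_lt
  all_goals exact h.1.elim (fun h => h.1.ge) le_of_lt

/-- The bound on the length of a movable segment, for a corridor in which long planar segments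
cannot pass through the door. -/
theorem movableLengths_sq_le {a b c L : ℝ} {i : Fin 2} {j : Fin 4} {R : ℝ → ℝ → Prop}
    (hR : ∀ x y, (x, y) ∈ planarCorridor a b i j → R x y)
    (hno : ∀ P Q : unitInterval → ℝ × ℝ, Continuous P → Continuous Q →
      (∀ t, OnSegment R (P t) (Q t)) →
      (∀ t, L < ((Q t).1 - (P t).1) ^ 2 + ((Q t).2 - (P t).2) ^ 2) →
      (P 0).1 ≤ a ∧ (Q 0).1 ≤ a → a ≤ (P 1).1 ∧ a ≤ (Q 1).1 → False)
    {ℓ : ℝ} (hℓ : ℓ ∈ movableLengths a b c i j) : ℓ ^ 2 ≤ L + c ^ 2 := by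
  obtain ⟨-, p, q, hpq, Φ, hΦ, hΦ0, hΦ1, hΦt⟩ := hℓ
  by_contra! hlt
  have hpt (t) {s : ℝ} (h0 : 0 < s) (h1 : s < 1) :
      (1 - s) • Φ t p + s • Φ t q ∈ Φ t '' openSegment ℝ p q := by
    refine ⟨(1 - s) • p + s • q, ⟨1 - s, s, by linarith, h0, by ring, rfl⟩, ?_⟩
    have := (Φ t).toAffineEquiv.toAffineMap.apply_lineMap p q s
    simpa [AffineMap.lineMap_apply_module] using this
  have hz t s (h0 : 0 < s) (h1 : s < 1) := (hΦt t (hpt t h0 h1)).2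
  have hx t s (h0 : 0 < s) (h1 : s < 1) := (hΦt t (hpt t h0 h1)).1
  have h0 s (h0 : 0 < s) (h1 : s < 1) := regionA_le (hΦ0 (hpt 0 h0 h1)).1
  have h1 s (h0 : 0 < s) (h1 : s < 1) := le_regionB (hΦ1 (hpt 1 h0 h1)).1
  simp only [PiLp.add_apply, PiLp.smul_apply, smul_eq_mul] at hz hx h0 h1
  have hcont (v : Space) (k : Fin 3) : Continuous fun t => Φ t v k :=
    (EuclideanSpace.proj (𝕜 := ℝ) k).continuous.comp (hΦ v)
  refine hno (fun t => (Φ t p 0, Φ t p 1)) (fun t => (Φ t q 0, Φ t q 1))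
    ((hcont p 0).prodMk (hcont p 1)) ((hcont q 0).prodMk (hcont q 1))
    (fun t s h0 h1 => hR _ _ (hx t s h0 h1)) (fun t => ?_) (endpoints_le h0) (endpoints_ge h1)
  have hlo := endpoints_nonneg fun s h0 h1 => (hz t s h0 h1).1.le
  have hhi := endpoints_le fun s h0 h1 => (hz t s h0 h1).2.le
  have hd : dist (Φ t p) (Φ t q) = ℓ := by rw [(Φ t).dist_map, hpq]
  rw [EuclideanSpace.dist_eq, Fin.sum_univ_three] at hd
  simp only [Real.dist_eq, sq_abs] at hd
  have hd2 : (Φ t p 0 - Φ t q 0) ^ 2 + (Φ t p 1 - Φ t q 1) ^ 2 + (Φ t p 2 - Φ t q 2) ^ 2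
      = ℓ ^ 2 := by
    rw [← hd, Real.sq_sqrt (by positivity)]
  -- The height difference is at most `c`, which leaves more than `L` for the squared planar length.
  have := sq_le_sq' (a := Φ t p 2 - Φ t q 2) (b := c)
    (by linarith [hlo.1, hhi.2]) (by linarith [hlo.2, hhi.1])
  simp only
  nlinarith

theorem movableLengths_quadrant_le {α β c : ℝ} (hα : 0 < α) (hβ : 0 < β)
    {ℓ : ℝ} (hℓ : ℓ ∈ movableLengths (α ^ 3) (β ^ 3) c 1 1) :
    ℓ ^ 2 ≤ (α ^ 2 + β ^ 2) ^ 3 + c ^ 2 :=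
  movableLengths_sq_le (fun _ _ => mem_planarCorridor_quadrant (pow_pos hα 3))
    (fun _ _ hP hQ hseg hlen h0 h1 => no_long_crossing (F := quadrantGap α β)
      (fun _ _ h e => ⟨h.2.1, h.2.2 e⟩) (fun _ _ => quadrantGap_comm)
      (fun _ _ => quadrant_left hα hβ) (fun _ _ => quadrant_right hα hβ)
      (fun _ _ => quadrant_cross hα hβ) hP hQ (by unfold quadrantGap; fun_prop)
      hseg hlen h0 h1) hℓ

theorem movableLengths_halfStrip_le {α β c : ℝ} (hα : 0 < α) (hβ : 0 < β)
    {ℓ : ℝ} (hℓ : ℓ ∈ movableLengths (α ^ 3) (β ^ 3) c 0 3) :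
    ℓ ^ 2 ≤ (α ^ 2 + β ^ 2) ^ 3 + c ^ 2 :=
  movableLengths_sq_le (fun _ _ => mem_planarCorridor_halfStrip (pow_pos hα 3))
    (fun _ _ hP hQ hseg hlen h0 h1 => no_long_crossing (F := halfStripGap α β)
      (fun _ _ h e => h.2 e.ge) (fun _ _ => halfStripGap_comm)
      (fun _ _ h hl hPQ hQ _ => halfStrip_left hα hβ h hl hPQ hQ)
      (fun _ _ h hl hPQ hP _ => halfStrip_right hα hβ h hl hPQ hP)
      (fun _ _ => halfStrip_cross hα hβ) hP hQ (by unfold halfStripGap; fun_prop)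
      hseg hlen h0 h1) hℓ

/-! ### Moving segments -/

theorem regionA_one_subset (a b : ℝ) (i : Fin 2) : regionA a b 1 ⊆ regionA a b i := by
  fin_cases i
  · exact inter_subset_left
  · exact subset_rfl

/-- The corridors become larger if the two regions do. -/
theorem movableLengths_mono {a b c : ℝ} {i i' : Fin 2} {j j' : Fin 4}
    (hi : regionA a b i ⊆ regionA a b i') (hj : regionB a b j ⊆ regionB a b j') :
    movableLengths a b c i j ⊆ movableLengths a b c i' j' := by
  rintro ℓ ⟨hℓ, p, q, hpq, Φ, hΦ, h0, h1, ht⟩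
  have hcyl {X Y : Set (ℝ × ℝ)} (h : X ⊆ Y) : cylinder X c ⊆ cylinder Y c :=
    fun v hv => ⟨h hv.1, hv.2⟩
  exact ⟨hℓ, p, q, hpq, Φ, hΦ, h0.trans (hcyl hi), h1.trans (hcyl hj),
    fun t => (ht t).trans (hcyl (union_subset_union hi hj))⟩

theorem spatial_continuous_iff {X : Type*} [TopologicalSpace X] {f : X → Space} :
    Continuous f ↔ ∀ k, Continuous fun x => f x k := by
  refine ⟨fun h k => (EuclideanSpace.proj (𝕜 := ℝ) k).continuous.comp h, fun h => ?_⟩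
  exact (PiLp.continuous_toLp 2 _).comp (continuous_pi h)

/-- The rotation about the `z`-axis by the angle `-φ`. -/
noncomputable def zRotation (φ : ℝ) : Space ≃ₗᵢ[ℝ] Space where
  toFun v := !₂[Real.cos φ * v 0 + Real.sin φ * v 1, -Real.sin φ * v 0 + Real.cos φ * v 1, v 2]
  invFun v := !₂[Real.cos φ * v 0 - Real.sin φ * v 1, Real.sin φ * v 0 + Real.cos φ * v 1, v 2]
  map_add' v w := by ext k; fin_cases k <;> simp <;> ring
  map_smul' r v := by ext k; fin_cases k <;> simp <;> ring
  left_inv v := by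
    have := Real.sin_sq_add_cos_sq φ
    ext k
    fin_cases k <;> simp
    · linear_combination v 0 * this
    · linear_combination v 1 * this
  right_inv v := by
    have := Real.sin_sq_add_cos_sq φ
    ext k
    fin_cases k <;> simp
    · linear_combination v 0 * this
    · linear_combination v 1 * this
  norm_map' v := by
    have := Real.sin_sq_add_cos_sq φ
    simp only [EuclideanSpace.norm_eq, Fin.sum_univ_three, Real.norm_eq_abs, sq_abs]
    congr 1
    simp
    linear_combination (v 0 ^ 2 + v 1 ^ 2) * this

/-- The rotation about the `z`-axis by the angle `-φ`, followed by the translation by `w`. -/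
noncomputable def screw (φ : ℝ) (w : Space) : Space ≃ᵃⁱ[ℝ] Space :=
  (zRotation φ).toAffineIsometryEquiv.trans (AffineIsometryEquiv.constVAdd ℝ Space w)

theorem screw_apply (φ : ℝ) (w v : Space) : screw φ w v =
    !₂[w 0 + (Real.cos φ * v 0 + Real.sin φ * v 1),
      w 1 + (-Real.sin φ * v 0 + Real.cos φ * v 1), w 2 + v 2] := by
  ext k
  fin_cases k <;> simp [screw, zRotation]

/-- A segment that moves along a path of screw motions around the corner has a movable length. -/
theorem mem_movableLengths {a b c : ℝ} {i : Fin 2} {j : Fin 4} {ℓ h k d : ℝ} {φ x y z : ℝ → ℝ}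
    (hℓ : 0 < ℓ) (hlen : h ^ 2 + k ^ 2 + d ^ 2 = ℓ ^ 2)
    (hφ : Continuous φ) (hx : Continuous x) (hy : Continuous y) (hz : Continuous z)
    (hmem : ∀ t s, 0 ≤ t → t ≤ 1 → 0 < s → s < 1 →
      (x t + s * (Real.cos (φ t) * h + Real.sin (φ t) * k),
        y t + s * (-Real.sin (φ t) * h + Real.cos (φ t) * k)) ∈ planarCorridor a b i j ∧
      0 < z t + s * d ∧ z t + s * d < c)
    (h0 : ∀ s, 0 < s → s < 1 →
      (x 0 + s * (Real.cos (φ 0) * h + Real.sin (φ 0) * k),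
        y 0 + s * (-Real.sin (φ 0) * h + Real.cos (φ 0) * k)) ∈ regionA a b i)
    (h1 : ∀ s, 0 < s → s < 1 →
      (x 1 + s * (Real.cos (φ 1) * h + Real.sin (φ 1) * k),
        y 1 + s * (-Real.sin (φ 1) * h + Real.cos (φ 1) * k)) ∈ regionB a b j) :
    ℓ ∈ movableLengths a b c i j := by
  have himage (t : ℝ) {X : Set (ℝ × ℝ)} (H : ∀ s, 0 < s → s < 1 →
      (x t + s * (Real.cos (φ t) * h + Real.sin (φ t) * k),
        y t + s * (-Real.sin (φ t) * h + Real.cos (φ t) * k)) ∈ X ∧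
      0 < z t + s * d ∧ z t + s * d < c) :
      screw (φ t) !₂[x t, y t, z t] '' openSegment ℝ 0 !₂[h, k, d] ⊆ cylinder X c := by
    rintro _ ⟨_, ⟨r, s, hr, hs, hrs, rfl⟩, rfl⟩
    have := H s hs (by linarith)
    rw [screw_apply]
    simp only [cylinder, mem_ofPred_eq]
    convert this using 4 <;> simp <;> ring
  refine ⟨hℓ, 0, !₂[h, k, d], ?_, fun t => screw (φ t) !₂[x t, y t, z t], fun v => ?_, ?_, ?_, ?_⟩
  · rw [EuclideanSpace.dist_eq, Fin.sum_univ_three]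
    simp [Real.dist_eq]
    rw [hlen, Real.sqrt_sq hℓ.le]
  · simp only [screw_apply]
    rw [spatial_continuous_iff]
    intro m
    fin_cases m <;> simp <;> fun_prop
  · exact himage 0 fun s hs hs' => ⟨h0 s hs hs', (hmem 0 s le_rfl zero_le_one hs hs').2⟩
  · exact himage 1 fun s hs hs' => ⟨h1 s hs hs', (hmem 1 s zero_le_one le_rfl hs hs').2⟩
  · exact fun t => himage t fun s hs hs' => hmem t s t.2.1 t.2.2 hs hs'

/-- A long segment slides along a line that passes through the door from the upper left to the
lower right, or from the lower left to the upper right. -/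
theorem mem_movableLengths_of_slide {a b c ℓ : ℝ} (ha : 0 < a) (hb : 0 < b) (hc : 0 < c)
    (hℓ : 0 < ℓ) : ℓ ∈ movableLengths a b c 1 2 ∧ ℓ ∈ movableLengths a b c 0 1 := by
  -- The width `h` is at most `a`, so the strip can hold the segment; the rest of the length goes
  -- into the unbounded vertical direction.
  obtain ⟨h, k, hh, hha, hk, hlen⟩ : ∃ h k : ℝ, 0 < h ∧ h ≤ a ∧ 0 ≤ k ∧ h ^ 2 + k ^ 2 = ℓ ^ 2 := by
    refine ⟨min a ℓ, √(ℓ ^ 2 - min a ℓ ^ 2), lt_min ha hℓ, min_le_left _ _,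
      Real.sqrt_nonneg _, ?_⟩
    rw [Real.sq_sqrt (sub_nonneg.2 (pow_le_pow_left₀ (lt_min ha hℓ).le (min_le_right _ _) 2))]
    ring
  have hxneg {r : ℝ} (h1 : -1 < r) (h2 : r < 0) : 0 < a + r * h ∧ a + r * h < a :=
    ⟨by nlinarith, by nlinarith⟩
  have hxpos {r : ℝ} (h1 : 0 < r) : a < a + r * h := by nlinarith
  -- The line is parametrised by `r`, with `r = 0` at the middle of the door. At time `t` the
  -- segment occupies `t - 1 < r < t`.
  have key {i : Fin 2} {j : Fin 4} (k : ℝ) (hlen : h ^ 2 + k ^ 2 = ℓ ^ 2)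
      (hA : ∀ r, -1 < r → r < 0 → (a + r * h, b / 2 + r * k) ∈ regionA a b i)
      (hB : ∀ r, 0 < r → r < 1 → (a + r * h, b / 2 + r * k) ∈ regionB a b j)
      (hD : (a, b / 2) ∈ regionA a b i) : ℓ ∈ movableLengths a b c i j := by
    refine mem_movableLengths (h := h) (k := k) (d := 0) (φ := fun _ => 0)
      (x := fun t => a + (t - 1) * h) (y := fun t => b / 2 + (t - 1) * k) (z := fun _ => c / 2)
      hℓ (by linarith) (by fun_prop) (by fun_prop) (by fun_prop) (by fun_prop) ?_ ?_ ?_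
    · intro t s ht0 ht1 hs0 hs1
      refine ⟨?_, by linarith, by linarith⟩
      have e : (a + (t - 1) * h + s * (Real.cos 0 * h + Real.sin 0 * k),
          b / 2 + (t - 1) * k + s * (-Real.sin 0 * h + Real.cos 0 * k)) =
          (a + (t - 1 + s) * h, b / 2 + (t - 1 + s) * k) := by
        simp only [Real.cos_zero, Real.sin_zero]; ext <;> simp <;> ring
      simp only [e]
      rcases lt_trichotomy (t - 1 + s) 0 with hr | hr | hr
      · exact Or.inl (hA _ (by linarith) hr)
      · rw [hr, zero_mul, zero_mul, add_zero, add_zero]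
        exact Or.inl hD
      · exact Or.inr (hB _ hr (by linarith))
    · intro s hs0 hs1
      convert hA (s - 1) (by linarith) (by linarith) using 2 <;> simp <;> ring
    · intro s hs0 hs1
      convert hB s hs0 hs1 using 2 <;> simp
  constructor
  · refine key (-k) (by linarith) (fun r h1 h2 => ⟨Or.inr (hxneg h1 h2), ?_⟩)
      (fun r h1 h2 => ⟨Or.inr (hxpos h1), ?_⟩) ⟨Or.inl ⟨rfl, by positivity, half_lt_self hb⟩, ?_⟩
    · show 0 < b / 2 + r * -k
      nlinarith
    · show b / 2 + r * -k < b
      nlinarith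
    · exact half_pos hb
  · refine key k hlen (fun r h1 h2 => Or.inr (hxneg h1 h2))
      (fun r h1 h2 => ⟨Or.inr (hxpos h1), ?_⟩) (Or.inl ⟨rfl, by positivity, half_lt_self hb⟩)
    show 0 < b / 2 + r * k
    nlinarith

/-! ### The sliding ladder in the corridor `S_13` -/

/-- A special case of Radon's inequality. -/
theorem radon_cube {u v s : ℝ} (hu : 0 < u) (hv : 0 < v) (h0 : 0 < s) (h1 : s < 1) :
    (u + v) ^ 3 ≤ u ^ 3 / s ^ 2 + v ^ 3 / (1 - s) ^ 2 := by
  -- Tangent bound: with `k = u + v`, `x ^ 3 - 3 * k ^ 2 * r ^ 2 * x + 2 * r ^ 3 * k ^ 3 = (x - r *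
  -- k) ^ 2 * (x + 2 * r * k)`. The two instances, for `(u, s)` and `(v, 1 - s)`, add up to `k ^ 3`.
  have key {x r : ℝ} (hx : 0 < x) (hr : 0 < r) :
      3 * (u + v) ^ 2 * x - 2 * r * (u + v) ^ 3 ≤ x ^ 3 / r ^ 2 := by
    rw [le_div_iff₀ (by positivity)]
    nlinarith [mul_nonneg (sq_nonneg (x - r * (u + v)))
      (show 0 ≤ x + 2 * (r * (u + v)) by positivity)]
  have h2 := key hu h0
  have h3 := key hv (sub_pos.2 h1)
  nlinarith

/-- A segment of less than the critical length whose ends move on the axes avoids the corner. -/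
theorem avoids_corner {α β r s θ : ℝ} (hα : 0 < α) (hβ : 0 < β) (h0 : 0 < s) (h1 : s < 1)
    (hr : r ^ 2 < (α ^ 2 + β ^ 2) ^ 3)
    (hx : α ^ 3 ≤ s * (r * Real.cos θ)) (hy : β ^ 3 ≤ (1 - s) * (r * Real.sin θ)) : False := by
  have h2 := radon_cube (pow_pos hα 2) (pow_pos hβ 2) h0 h1
  have hx' : (α ^ 2) ^ 3 / s ^ 2 ≤ (r * Real.cos θ) ^ 2 := by
    rw [div_le_iff₀ (by positivity)]
    calc (α ^ 2) ^ 3 = (α ^ 3) ^ 2 := by ring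
      _ ≤ (s * (r * Real.cos θ)) ^ 2 := pow_le_pow_left₀ (by positivity) hx 2
      _ = _ := by ring
  have hy' : (β ^ 2) ^ 3 / (1 - s) ^ 2 ≤ (r * Real.sin θ) ^ 2 := by
    rw [div_le_iff₀ (pow_pos (sub_pos.2 h1) 2)]
    calc (β ^ 2) ^ 3 = (β ^ 3) ^ 2 := by ring
      _ ≤ ((1 - s) * (r * Real.sin θ)) ^ 2 := pow_le_pow_left₀ (by positivity) hy 2
      _ = _ := by ring
  have : (r * Real.cos θ) ^ 2 + (r * Real.sin θ) ^ 2 = r ^ 2 := by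
    linear_combination r ^ 2 * Real.sin_sq_add_cos_sq θ
  linarith

theorem mem_planarCorridor_of_avoids {a b x y : ℝ} (hx : 0 < x) (hy : 0 < y)
    (h : a ≤ x → y < b) : (x, y) ∈ planarCorridor a b 1 3 := by
  rcases lt_trichotomy x a with hxa | rfl | hxa
  · exact Or.inl ⟨Or.inr ⟨hx, hxa⟩, hy⟩
  · exact Or.inl ⟨Or.inl ⟨rfl, hy, h le_rfl⟩, hy⟩
  · exact Or.inr ⟨Or.inr hxa, hy, h hxa.le⟩

/-- Segments of less than the critical length can move around the corner of the narrowest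
corridor. -/
theorem mem_movableLengths_of_sq_lt {α β c ℓ : ℝ} (hα : 0 < α) (hβ : 0 < β) (hc : 0 < c)
    (hℓ : 0 < ℓ) (hlt : ℓ ^ 2 < (α ^ 2 + β ^ 2) ^ 3 + c ^ 2) :
    ℓ ∈ movableLengths (α ^ 3) (β ^ 3) c 1 3 := by
  -- The extremal pair (planar length `L`, height `c`) is scaled by `ℓ / M < 1`, which makes both
  -- components strictly subcritical.
  obtain ⟨r, d, hr, hd, hdc, hlen, hrL⟩ : ∃ r d : ℝ, 0 < r ∧ 0 < d ∧ d < c ∧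
      r ^ 2 + d ^ 2 = ℓ ^ 2 ∧ r ^ 2 < (α ^ 2 + β ^ 2) ^ 3 := by
    set L := √((α ^ 2 + β ^ 2) ^ 3) with hL
    have hL2 : L ^ 2 = (α ^ 2 + β ^ 2) ^ 3 := Real.sq_sqrt (by positivity)
    have hL0 : 0 < L := Real.sqrt_pos.2 (by positivity)
    set M := √(L ^ 2 + c ^ 2) with hM
    have hM2 : M ^ 2 = L ^ 2 + c ^ 2 := Real.sq_sqrt (by positivity)
    have hM0 : 0 < M := Real.sqrt_pos.2 (by positivity)
    have hμ : ℓ / M < 1 := by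
      rw [div_lt_one hM0]
      exact lt_of_pow_lt_pow_left₀ 2 hM0.le (by linarith)
    have hμ0 : 0 < ℓ / M := div_pos hℓ hM0
    refine ⟨ℓ / M * L, ℓ / M * c, by positivity, by positivity, by nlinarith, ?_, ?_⟩
    · rw [mul_pow, mul_pow, ← mul_add, ← hM2, div_pow, div_mul_cancel₀ _ (by positivity)]
    · rw [← hL2]
      exact pow_lt_pow_left₀ (by nlinarith) (by positivity) two_ne_zero
  -- A slightly smaller corner is still passable. The slack moves the guiding lines from the axes,
  -- which lie outside the corridor, to `x = α ^ 3 - α' ^ 3` and `y = β ^ 3 - β' ^ 3`.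
  obtain ⟨α', β', hα', hαlt, hβ', hβlt, hrL'⟩ : ∃ α' β' : ℝ, 0 < α' ∧ α' < α ∧ 0 < β' ∧ β' < β ∧
      r ^ 2 < (α' ^ 2 + β' ^ 2) ^ 3 := by
    have hcont : Continuous fun x : ℝ => ((x * α) ^ 2 + (x * β) ^ 2) ^ 3 := by fun_prop
    have hev := (hcont.tendsto 1).eventually (lt_mem_nhds (by simpa using hrL))
    obtain ⟨x, ⟨hx, hx0⟩, hx1⟩ := ((hev.and (lt_mem_nhds zero_lt_one)).filter_mono
      (nhdsWithin_le_nhds (s := Iio 1)) |>.and self_mem_nhdsWithin).exists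
    have hx1 : x < 1 := hx1
    exact ⟨x * α, x * β, by positivity, by nlinarith, by positivity, by nlinarith, hx⟩
  have hα3 : α' ^ 3 < α ^ 3 := pow_lt_pow_left₀ hαlt hα'.le (by norm_num)
  have hβ3 : β' ^ 3 < β ^ 3 := pow_lt_pow_left₀ hβlt hβ'.le (by norm_num)
  have hα'3 : 0 < α' ^ 3 := by positivity
  have hβ'3 : 0 < β' ^ 3 := by positivity
  -- Until `t = 1 / 2` the segment turns from vertical to horizontal with its ends on the two
  -- guiding lines; afterwards it is translated by `α ^ 3` in the `x`-direction, past the wall. Its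
  -- tilt is fixed: the height runs from `0` to `d`, both excluded since the segment is open.
  refine mem_movableLengths (h := r) (k := 0) (d := d)
    (φ := fun t => Real.pi / 2 * max 0 (1 - 2 * t))
    (x := fun t => α ^ 3 - α' ^ 3 + α ^ 3 * max 0 (2 * t - 1))
    (y := fun t => β ^ 3 - β' ^ 3 + r * Real.sin (Real.pi / 2 * max 0 (1 - 2 * t)))
    (z := fun _ => 0)
    hℓ (by linarith) (by fun_prop) (by fun_prop) (by fun_prop) (by fun_prop) ?_ ?_ ?_
  · intro t s ht0 ht1 hs0 hs1
    refine ⟨?_, by nlinarith, by nlinarith⟩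
    rcases le_total t (1 / 2) with ht | ht
    · rw [max_eq_right (by linarith : 0 ≤ 1 - 2 * t), max_eq_left (by linarith : 2 * t - 1 ≤ 0)]
      set θ := Real.pi / 2 * (1 - 2 * t) with hθ
      have hpi := Real.pi_pos
      have hθ0 : 0 ≤ θ := mul_nonneg (by positivity) (by linarith)
      have hθ1 : θ ≤ Real.pi / 2 := mul_le_of_le_one_right (by positivity) (by linarith)
      have hcos := Real.cos_nonneg_of_mem_Icc ⟨by linarith, hθ1⟩
      have hsin := Real.sin_nonneg_of_nonneg_of_le_pi hθ0 (by linarith)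
      have hX : 0 ≤ s * (r * Real.cos θ) := by positivity
      have hY : 0 ≤ (1 - s) * (r * Real.sin θ) := mul_nonneg (by linarith) (by positivity)
      refine mem_planarCorridor_of_avoids (by linarith) (by linarith) fun hxa => ?_
      by_contra hyb
      exact avoids_corner (θ := θ) hα' hβ' hs0 hs1 hrL' (by linarith) (by linarith)
    · rw [max_eq_left (by linarith : 1 - 2 * t ≤ 0), max_eq_right (by linarith : 0 ≤ 2 * t - 1)]
      have := mul_nonneg (pow_pos hα 3).le (by linarith : 0 ≤ 2 * t - 1)
      have := mul_pos hs0 hr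
      simp only [mul_zero, Real.sin_zero, Real.cos_zero]
      exact mem_planarCorridor_of_avoids (by linarith) (by linarith) fun _ => by linarith
  · intro s hs0 hs1
    norm_num
    refine ⟨Or.inr ⟨?_, ?_⟩, ?_⟩
    · show 0 < α ^ 3 - α' ^ 3
      linarith
    · show α ^ 3 - α' ^ 3 < α ^ 3
      linarith
    · show 0 < β ^ 3 - β' ^ 3 + r + -(s * r)
      nlinarith
  · intro s hs0 hs1
    have := mul_pos hs0 hr
    norm_num
    refine ⟨Or.inr ?_, ?_, ?_⟩
    · show α ^ 3 < α ^ 3 - α' ^ 3 + α ^ 3 + s * r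
      linarith
    · show 0 < β ^ 3 - β' ^ 3
      linarith
    · show β ^ 3 - β' ^ 3 < β ^ 3
      linarith

/-! ### Suprema and unbounded cases -/

theorem corollary3 (a b c : ℝ) (ha : 0 < a) (hb : 0 < b) (hc : 0 < c)
    (i : Fin 2) (j : Fin 4) :
    ((i, j) ∈ ({(0, 3), (1, 1), (1, 3)} : Set (Fin 2 × Fin 4)) →
      IsLUB (movableLengths a b c i j)
        (((a ^ (2 / 3 : ℝ) + b ^ (2 / 3 : ℝ)) ^ 3 + c ^ 2) ^ (1 / 2 : ℝ))) ∧
    ((i, j) ∉ ({(0, 3), (1, 1), (1, 3)} : Set (Fin 2 × Fin 4)) →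
      ∀ ℓ : ℝ, 0 < ℓ → ℓ ∈ movableLengths a b c i j) := by
  have hB20 : regionB a b 2 ⊆ regionB a b 0 := inter_subset_left
  have hB31 : regionB a b 3 ⊆ regionB a b 1 := fun p hp => ⟨hp.1, hp.2.1⟩
  constructor
  · intro hij
    obtain ⟨α, hα, rfl, hα2⟩ : ∃ α : ℝ, 0 < α ∧ a = α ^ 3 ∧ a ^ (2 / 3 : ℝ) = α ^ 2 := by
      refine ⟨a ^ (1 / 3 : ℝ), by positivity, ?_, ?_⟩ <;>
        rw [← Real.rpow_natCast, ← Real.rpow_mul ha.le] <;> norm_num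
    obtain ⟨β, hβ, rfl, hβ2⟩ : ∃ β : ℝ, 0 < β ∧ b = β ^ 3 ∧ b ^ (2 / 3 : ℝ) = β ^ 2 := by
      refine ⟨b ^ (1 / 3 : ℝ), by positivity, ?_, ?_⟩ <;>
        rw [← Real.rpow_natCast, ← Real.rpow_mul hb.le] <;> norm_num
    rw [hα2, hβ2, ← Real.sqrt_eq_rpow]
    -- Each of the three corridors contains `S_13`, which gives the lower bound; `S_13` takes its
    -- upper bound from `S_11`.
    obtain ⟨hsub, hle⟩ :
        movableLengths (α ^ 3) (β ^ 3) c 1 3 ⊆ movableLengths (α ^ 3) (β ^ 3) c i j ∧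
        ∀ ℓ ∈ movableLengths (α ^ 3) (β ^ 3) c i j, ℓ ^ 2 ≤ (α ^ 2 + β ^ 2) ^ 3 + c ^ 2 := by
      simp only [mem_insert_iff, mem_singleton_iff, Prod.mk.injEq] at hij
      rcases hij with ⟨rfl, rfl⟩ | ⟨rfl, rfl⟩ | ⟨rfl, rfl⟩
      · exact ⟨movableLengths_mono (regionA_one_subset _ _ _) subset_rfl,
          fun ℓ hℓ => movableLengths_halfStrip_le hα hβ hℓ⟩
      · exact ⟨movableLengths_mono subset_rfl hB31,
          fun ℓ hℓ => movableLengths_quadrant_le hα hβ hℓ⟩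
      · exact ⟨subset_rfl, fun ℓ hℓ => movableLengths_quadrant_le hα hβ
          (movableLengths_mono subset_rfl hB31 hℓ)⟩
    refine ⟨fun ℓ hℓ => Real.le_sqrt_of_sq_le (hle ℓ hℓ), fun M hM => ?_⟩
    refine le_of_forall_lt fun ℓ hℓ => ?_
    -- The maximum with `0` ensures that the comparison length is positive, as a movable length must
    -- be.
    obtain ⟨m, hm, hm'⟩ := exists_between (max_lt hℓ (Real.sqrt_pos.2
      (show 0 < (α ^ 2 + β ^ 2) ^ 3 + c ^ 2 by positivity)))
    have hm0 : 0 < m := (le_max_right _ _).trans_lt hm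
    exact ((le_max_left _ _).trans_lt hm).trans_le (hM (hsub (mem_movableLengths_of_sq_lt hα hβ hc
      hm0 ((Real.lt_sqrt hm0.le).1 hm'))))
  · intro hij ℓ hℓ
    obtain ⟨h12, h01⟩ := mem_movableLengths_of_slide ha hb hc hℓ
    fin_cases i <;> fin_cases j <;> simp at hij
    · exact movableLengths_mono (regionA_one_subset _ _ _) hB20 h12
    · exact h01
    · exact movableLengths_mono (regionA_one_subset _ _ _) subset_rfl h12
    · exact movableLengths_mono subset_rfl hB20 h12
    · exact h12
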